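/- Let $L$ be a first-order language and let $\mathcal U$ be a saturated $L$-structure whose cardinality $\kappa$ is an (uncountable, strongly) inaccessible cardinal with $\kappa>|L|$. Let $A\subseteq\mathcal U$ be a set of cardinality $<\kappa$, let $n$ be a natural number and let $\mathcal D\subseteq\mathcal U^{n}$ be an arbitrary set of $n$-tuples. Let $$o(\mathcal D/A)=\{f[\mathcal D] : f\in\mathrm{Aut}(\mathcal U/A)\}$$ be the orbit of $\mathcal D$ under the group $\mathrm{Aut}(\mathcal U/A)$ of automorphisms of $\mathcal U$ that fix $A$ pointwise, and let $|L(A)|$ be the number of first-order $L$-formulas with parameters from $A$. Then the following are equivalent: 1. $o(\mathcal D/A)$ has cardinality $<\kappa$; 2. $o(\mathcal D/A)$ has cardinality $\le 2^{2^{|L(A)|}}$. -/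

import Mathlib

open FirstOrder Cardinal

universe u v w

namespace LascarOrbit

/-- A structure `U` is saturated if, for every set of parameters `A ⊆ U` of cardinality smaller
than that of `U`, every finitely consistent set of formulas over `A` in finitely many variables
is realized in `U`. -/
def IsSaturated (L : FirstOrder.Language.{u, v}) (U : Type w) [L.Structure U] : Prop :=
  ∀ A : Set U, #A < #U → ∀ (n : ℕ) (p : Set (L[[A]].Formula (Fin n))),
    (∀ q : Finset (L[[A]].Formula (Fin n)), (q : Set (L[[A]].Formula (Fin n))) ⊆ p →
      ∃ x : Fin n → U, ∀ φ ∈ q, φ.Realize x) →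
    ∃ x : Fin n → U, ∀ φ ∈ p, φ.Realize x

/-- `|L(A)|`: the number of first-order formulas (in countably many variables) with
parameters from `A`. -/
def cardFormulas (L : FirstOrder.Language.{u, v}) {U : Type w} (A : Set U) : Cardinal.{max u v w} :=
  #(L[[A]].Formula ℕ)

/-- The orbit `o(D/A) = { f[D] : f ∈ Aut(U/A) }` of a set `D` of `n`-tuples, where `Aut(U/A)`
consists of the automorphisms of `U` that fix `A` pointwise. -/
def orbit (L : FirstOrder.Language.{u, v}) {U : Type w} [L.Structure U] {n : ℕ} (A : Set U)
    (D : Set (Fin n → U)) : Set (Set (Fin n → U)) :=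
  {C | ∃ f : U ≃[L] U, (∀ a ∈ A, f a = a) ∧ C = (fun t : Fin n → U => f ∘ t) '' D}

end LascarOrbit

namespace LascarOrbit

open FirstOrder.Language Order Set Filter

/-!
Suppose the orbit of `D` over `A` is small. Belonging to the same conjugates of `D` is then an
equivalence relation `~` on tuples with few classes, and it is invariant over every model
`M ⊇ A`. Such a relation is coarser than equality of types over `M`. Indeed, let `a` and `b` have
the same type over `M`, and let `F` be an ultrafilter on tuples of `M` whose average type over `M`
is that common type. Choose `c` realizing the average type of `F` over `M`, `a`, `b` and a set of
representatives, one for each `~`-class of realizations of `tp (a / M)`. Some representative `x`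
satisfies `x ~ c`. As the average type is invariant over `M`, the pairs `(x, c)`, `(a, c)` and
`(b, c)` have the same type over `M`, so strong homogeneity gives `a ~ c ~ b`.

Hence every conjugate of `D` is a union of classes of equality of types over `M`. For `M` of size
`|L(A)|` there are at most `2 ^ |L(A)|` classes, and so at most `2 ^ 2 ^ |L(A)|` conjugates.
-/

section TransfiniteExtension

variable {α ι : Type w} {F : Set (Set α)} {R : Set α}

theorem union_image_mem_of_forall_Iic [LinearOrder ι] (hF : IsOfFiniteCharacter F) (hR : R ∈ F)
    (g : ι → α) {T : Set ι} (h : ∀ i ∈ T, R ∪ g '' Iic i ∈ F) : R ∪ g '' T ∈ F := by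
  refine (hF _).2 fun y hy hyfin => ?_
  obtain ⟨t, htT, htfin, hty⟩ : ∃ t ⊆ T, t.Finite ∧ y \ R = g '' t :=
    exists_subset_image_finite_and.1 ⟨y \ R, sdiff_subset_iff.2 hy, hyfin.sdiff, rfl⟩
  have hyt : y ⊆ R ∪ g '' t := by simp [← hty]
  obtain rfl | ht := t.eq_empty_or_nonempty
  · exact (hF R).1 hR y (by simpa using hyt) hyfin
  · obtain ⟨i, hi, hmax⟩ := exists_max_image t id htfin ht
    exact (hF _).1 (h i (htT hi)) y
      (hyt.trans (union_subset_union_right R (image_mono hmax))) hyfin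

theorem exists_superset_forall_inter_nonempty (hF : IsOfFiniteCharacter F) {κ : Cardinal.{w}}
    (hκ : ℵ₀ ≤ κ) (hι : #ι ≤ κ) (C : ι → Set α)
    (hext : ∀ S ∈ F, #S < κ → ∀ i, ∃ p ∈ C i, insert p S ∈ F) (hR : R ∈ F) (hRκ : #R < κ) :
    ∃ S ∈ F, R ⊆ S ∧ ∀ i, (S ∩ C i).Nonempty := by
  obtain hι' | ⟨⟨i₀⟩⟩ := isEmpty_or_nonempty ι
  · exact ⟨R, hR, subset_rfl, isEmptyElim⟩
  have : Nonempty α := ⟨(hext R hR hRκ i₀).choose⟩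
  choose! next hnextC hnextF using hext
  obtain ⟨_, _, hord⟩ := exists_ord_eq_type_lt ι
  let g : ι → α := wellFounded_lt.fix fun i ih => next (R ∪ range fun j : Iio i => ih j j.2) i
  have hg : ∀ i, g i = next (R ∪ g '' Iio i) i := fun i => by
    rw [image_eq_range]
    exact WellFounded.fix_eq _ _ i
  have hcard : ∀ i, #(R ∪ g '' Iio i : Set α) < κ := fun i =>
    (mk_union_le _ _).trans_lt
      (add_lt_of_lt hκ hRκ (mk_image_le.trans_lt ((mk_Iio_lt i hord).trans_le hι)))
  have hIic : ∀ i, R ∪ g '' Iio i ∈ F → R ∪ g '' Iic i ∈ F := fun i hi => by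
    rw [← Iio_insert, image_insert_eq, union_insert, hg i]
    exact hnextF _ hi (hcard i) i
  have hIio : ∀ i, R ∪ g '' Iio i ∈ F := fun i => by
    induction i using WellFoundedLT.induction with
    | ind i ih => exact union_image_mem_of_forall_Iic hF hR g fun j hj => hIic j (ih j hj)
  refine ⟨R ∪ g '' univ, union_image_mem_of_forall_Iic hF hR g fun i _ => hIic i (hIio i),
    subset_union_left, fun i => ⟨g i, .inr (mem_image_of_mem g (mem_univ i)), ?_⟩⟩
  rw [hg i]
  exact hnextC _ (hIio i) (hcard i) i

end TransfiniteExtension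

section Types

variable {L : FirstOrder.Language.{u, v}} {M N I J : Type*} [L.Structure M] [L.Structure N]

/-- A set of formulas is complete if it contains exactly one of each formula and its negation.
Consistency is not part of the definition. -/
def IsComplete (p : Set (L.Formula I)) : Prop :=
  ∀ φ : L.Formula I, φ.not ∈ p ↔ φ ∉ p

theorem IsComplete.eq_of_subset {p q : Set (L.Formula I)} (hp : IsComplete p) (hq : IsComplete q)
    (h : p ⊆ q) : p = q :=
  h.antisymm fun φ hφ => by
    by_contra hφp
    exact (hq φ).1 (h ((hp φ).2 hφp)) hφ

/-- The complete type of a tuple. It is encoded as a bare set of formulas, rather than as a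
`Theory.CompleteType`, in order to compare tuples of different structures, possibly empty, with no
ambient theory. -/
def tp (L : FirstOrder.Language.{u, v}) [L.Structure M] (a : I → M) : Set (L.Formula I) :=
  {φ | φ.Realize a}

theorem isComplete_tp (a : I → M) : IsComplete (tp L a) := fun _ => Formula.realize_not

theorem tp_comp (a : I → M) (g : J → I) : tp L (a ∘ g) = Formula.relabel g ⁻¹' tp L a :=
  Set.ext fun _ => Formula.realize_relabel.symm

theorem tp_comp_eq_of_tp_eq {a : I → M} {b : I → N} (h : tp L a = tp L b) (g : J → I) :
    tp L (a ∘ g) = tp L (b ∘ g) := by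
  rw [tp_comp, tp_comp, h]

theorem realize_iff_of_tp_eq {a : I → M} {b : I → N} (h : tp L a = tp L b) (φ : L.Formula I) :
    φ.Realize a ↔ φ.Realize b :=
  Set.ext_iff.1 h φ

theorem tp_eq_of_forall_finset {a : I → M} {b : I → N}
    (h : ∀ s : Finset I, tp L (fun i : s => a i) = tp L (fun i : s => b i)) :
    tp L a = tp L b := by
  classical
  ext φ
  have hφ := realize_iff_of_tp_eq (h φ.freeVarFinset) (BoundedFormula.restrictFreeVar φ id)
  exact (BoundedFormula.realize_restrictFreeVar (f := id) a fun _ => rfl).symm.trans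
    (hφ.trans (BoundedFormula.realize_restrictFreeVar (f := id) b fun _ => rfl))

theorem apply_eq_apply_iff_of_tp_eq {a : I → M} {b : I → N} (h : tp L a = tp L b) (i j : I) :
    a i = a j ↔ b i = b j := by
  simpa using realize_iff_of_tp_eq h (Term.equal (Term.var i) (Term.var j))

end Types

section ElementaryRelations

variable {L : FirstOrder.Language.{u, v}}

/-- A relation between two structures is elementary if it is the graph of a partial elementary
map. -/
def IsElementaryRel (L : FirstOrder.Language.{u, v}) {M N : Type*} [L.Structure M] [L.Structure N]
    (R : Set (M × N)) : Prop :=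
  tp L (fun p : R => p.1.1) = tp L (fun p : R => p.1.2)

variable {M N I : Type*} [L.Structure M] [L.Structure N] {R S : Set (M × N)}

theorem IsElementaryRel.mono (h : IsElementaryRel L S) (hRS : R ⊆ S) : IsElementaryRel L R :=
  tp_comp_eq_of_tp_eq h (inclusion hRS)

theorem IsElementaryRel.swap (h : IsElementaryRel L R) : IsElementaryRel L (Prod.swap '' R) := by
  rw [image_swap_eq_preimage_swap]
  exact (tp_comp_eq_of_tp_eq h fun p : Prod.swap ⁻¹' R => (⟨p.1.swap, p.2⟩ : R)).symm

theorem isOfFiniteCharacter_isElementaryRel :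
    IsOfFiniteCharacter {R : Set (M × N) | IsElementaryRel L R} := by
  classical
  refine fun R => ⟨fun h S hSR _ => IsElementaryRel.mono h hSR, fun h => ?_⟩
  refine tp_eq_of_forall_finset fun s => ?_
  have hs := h (s.image Subtype.val : Finset (M × N)) (by simp) (Finset.finite_toSet _)
  exact tp_comp_eq_of_tp_eq hs fun i : s => ⟨i.1.1, by simp⟩

theorem isElementaryRel_range {a : I → M} {b : I → N} (h : tp L a = tp L b) :
    IsElementaryRel L (range fun i => (a i, b i)) := by
  have hsplit := apply_rangeSplitting fun i => (a i, b i)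
  have hfst : (fun p : range fun i => (a i, b i) => p.1.1) = a ∘ rangeSplitting _ :=
    funext fun p => congrArg Prod.fst (hsplit p).symm
  have hsnd : (fun p : range fun i => (a i, b i) => p.1.2) = b ∘ rangeSplitting _ :=
    funext fun p => congrArg Prod.snd (hsplit p).symm
  rw [IsElementaryRel, hfst, hsnd]
  exact tp_comp_eq_of_tp_eq h _

theorem IsElementaryRel.exists_equiv (h : IsElementaryRel L R) (htotal : ∀ x, ∃ y, (x, y) ∈ R)
    (hsurj : ∀ y, ∃ x, (x, y) ∈ R) : ∃ f : M ≃[L] N, ∀ p ∈ R, f p.1 = p.2 := by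
  choose f hf using htotal
  have hfR : ∀ p ∈ R, f p.1 = p.2 := fun p hp =>
    (apply_eq_apply_iff_of_tp_eq h ⟨(p.1, f p.1), hf p.1⟩ ⟨p, hp⟩).1 rfl
  have htp : tp L (id : M → M) = tp L f := tp_comp_eq_of_tp_eq h fun x => ⟨(x, f x), hf x⟩
  let e : M ↪ₑ[L] N := ⟨f, fun _ φ x => (realize_iff_of_tp_eq (tp_comp_eq_of_tp_eq htp x) φ).symm⟩
  have hbij : Function.Bijective f := ⟨e.injective, fun y => (hsurj y).imp fun x hx => hfR _ hx⟩
  exact ⟨⟨Equiv.ofBijective f hbij, e.map_fun, e.map_rel⟩, hfR⟩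

end ElementaryRelations

section Saturation

variable {L : FirstOrder.Language.{u, v}}

theorem IsSaturated.exists_realize {U : Type w} [L.Structure U] (hU : IsSaturated L U) {I : Type*}
    (b : I → U) (hb : #(range b) < #U) {n : ℕ} (p : Set (L.Formula (I ⊕ Fin n)))
    (hp : ∀ q : Finset (L.Formula (I ⊕ Fin n)), ↑q ⊆ p →
      ∃ x : Fin n → U, ∀ φ ∈ q, φ.Realize (Sum.elim b x)) :
    ∃ x : Fin n → U, ∀ φ ∈ p, φ.Realize (Sum.elim b x) := by
  classical
  let toConstants (φ : L.Formula (I ⊕ Fin n)) : L[[range b]].Formula (Fin n) :=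
    BoundedFormula.constantsVarsEquiv.symm (φ.relabel (Sum.map (rangeFactorization b) id))
  have realize_toConstants : ∀ φ (x : Fin n → U),
      (toConstants φ).Realize x ↔ φ.Realize (Sum.elim b x) := fun φ x => by
    rw [Formula.Realize, ← BoundedFormula.realize_constantsVarsEquiv, Equiv.apply_symm_apply,
      ← Formula.Realize, Formula.realize_relabel, Sum.elim_comp_map]
    rfl
  obtain ⟨x, hx⟩ := hU (range b) hb n (toConstants '' p) fun q hq => by
    obtain ⟨q', hq', rfl⟩ := Finset.subset_set_image_iff.1 hq
    obtain ⟨x, hx⟩ := hp q' hq'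
    exact ⟨x, Finset.forall_mem_image.2 fun φ hφ => (realize_toConstants φ x).2 (hx φ hφ)⟩
  exact ⟨x, fun φ hφ => (realize_toConstants φ x).1 (hx _ (mem_image_of_mem toConstants hφ))⟩

variable {M N : Type w} [L.Structure M] [L.Structure N] {R : Set (M × N)}

theorem IsSaturated.exists_tp_elim_eq (hN : IsSaturated L N) {I : Type w} {a : I → M} {b : I → N}
    (hab : tp L a = tp L b) (hI : #I < #N) {n : ℕ} (x : Fin n → M) :
    ∃ y : Fin n → N, tp L (Sum.elim a x) = tp L (Sum.elim b y) := by
  obtain ⟨y, hy⟩ := hN.exists_realize b (mk_range_le.trans_lt hI) (tp L (Sum.elim a x))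
    fun q hq => by
      have ha : ((Formula.iInf fun φ : q => φ.1).iExs (Fin n)).Realize a :=
        Formula.realize_iExs.2 ⟨x, Formula.realize_iInf.2 fun φ => hq φ.2⟩
      obtain ⟨y, hy⟩ := Formula.realize_iExs.1 ((realize_iff_of_tp_eq hab _).1 ha)
      exact ⟨y, fun φ hφ => Formula.realize_iInf.1 hy ⟨φ, hφ⟩⟩
  exact ⟨y, (isComplete_tp _).eq_of_subset (isComplete_tp _) hy⟩

theorem IsElementaryRel.exists_insert_right (h : IsElementaryRel L R) (hN : IsSaturated L N)
    (hR : #R < #N) (x : M) : ∃ y, IsElementaryRel L (insert (x, y) R) := by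
  obtain ⟨y, hy⟩ := hN.exists_tp_elim_eq h hR fun _ : Fin 1 => x
  refine ⟨y 0, (isElementaryRel_range hy).mono (insert_subset ⟨.inr 0, rfl⟩ ?_)⟩
  exact fun p hp => ⟨.inl ⟨p, hp⟩, rfl⟩

theorem IsElementaryRel.exists_insert_left (h : IsElementaryRel L R) (hM : IsSaturated L M)
    (hR : #R < #M) (y : N) : ∃ x, IsElementaryRel L (insert (x, y) R) := by
  obtain ⟨x, hx⟩ := h.swap.exists_insert_right hM (mk_image_le.trans_lt hR) y
  exact ⟨x, by simpa [image_insert_eq, image_image] using hx.swap⟩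

theorem IsSaturated.exists_equiv_comp_eq (hM : IsSaturated L M) (hN : IsSaturated L N)
    (hMN : #M = #N) (hinf : ℵ₀ ≤ #M) {I : Type w} (hI : #I < #M) {a : I → M} {b : I → N}
    (hab : tp L a = tp L b) : ∃ f : M ≃[L] N, f ∘ a = b := by
  have hext : ∀ R : Set (M × N), IsElementaryRel L R → #R < #M → ∀ z : M ⊕ N,
      ∃ p ∈ Sum.elim (fun x => {p | p.1 = x}) (fun y => {p | p.2 = y}) z,
        IsElementaryRel L (insert p R) := by
    rintro R hR hRM (x | y)
    · exact (hR.exists_insert_right hN (hMN ▸ hRM) x).imp' (Prod.mk x) fun y hy => ⟨rfl, hy⟩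
    · exact (hR.exists_insert_left hM hRM y).imp' (·, y) fun x hx => ⟨rfl, hx⟩
  have hsum : #(M ⊕ N) ≤ #M := by simp [← hMN, add_eq_self hinf]
  obtain ⟨S, hS, hRS, hfull⟩ := exists_superset_forall_inter_nonempty
    isOfFiniteCharacter_isElementaryRel hinf hsum _ hext (isElementaryRel_range hab)
    (mk_range_le.trans_lt hI)
  obtain ⟨f, hf⟩ := IsElementaryRel.exists_equiv hS
    (fun x => by obtain ⟨⟨_, y⟩, hy, rfl⟩ := hfull (.inl x); exact ⟨y, hy⟩)
    (fun y => by obtain ⟨⟨x, _⟩, hx, rfl⟩ := hfull (.inr y); exact ⟨x, hx⟩)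
  exact ⟨f, funext fun i => hf _ (hRS ⟨i, rfl⟩)⟩

end Saturation

section AverageTypes

variable {L : FirstOrder.Language.{u, v}} {I J K : Type*}

/-- The average type, over the parameters `b`, of an ultrafilter `F` on tuples: the formulas over
`b` that hold for `F`-almost all tuples. -/
def averageType (L : FirstOrder.Language.{u, v}) {U : Type*} [L.Structure U]
    (F : Ultrafilter (J → U)) (b : I → U) : Set (L.Formula (I ⊕ J)) :=
  {φ | ∀ᶠ m in F, φ.Realize (Sum.elim b m)}

theorem isComplete_averageType {U : Type*} [L.Structure U] (F : Ultrafilter (J → U)) (b : I → U) :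
    IsComplete (averageType L F b) := fun _ => Ultrafilter.eventually_not

theorem averageType_comp {U : Type*} [L.Structure U] (F : Ultrafilter (J → U)) (b : I → U)
    (g : K → I) : averageType L F (b ∘ g) = Formula.relabel (Sum.map g id) ⁻¹' averageType L F b :=
  Set.ext fun φ => eventually_congr <| .of_forall fun m => by
    rw [Formula.realize_relabel, Sum.elim_comp_map, Function.comp_id]

theorem tp_elim_comp_eq_averageType {U : Type*} [L.Structure U] {F : Ultrafilter (J → U)}
    {b : I → U} {c : J → U} (h : tp L (Sum.elim b c) = averageType L F b) (g : K → I) :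
    tp L (Sum.elim (b ∘ g) c) = averageType L F (b ∘ g) := by
  rw [averageType_comp, ← h, ← tp_comp, Sum.elim_comp_map, Function.comp_id]

theorem averageType_elim_eq_of_tp_elim_eq {U : Type*} [L.Structure U] {F : Ultrafilter (J → U)}
    {b : I → U} (hF : ∀ᶠ m : J → U in F, range m ⊆ range b) {x y : K → U}
    (hxy : tp L (Sum.elim b x) = tp L (Sum.elim b y)) :
    averageType L F (Sum.elim b x) = averageType L F (Sum.elim b y) := by
  ext φ
  refine eventually_congr (hF.mono fun m hm => realize_iff_of_tp_eq ?_ φ)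
  obtain ⟨g, rfl⟩ := range_subset_range_iff_exists_comp.1 hm
  simpa only [Sum.comp_elim, Function.comp_id, Sum.elim_comp_inl, ← Function.comp_assoc]
    using tp_comp_eq_of_tp_eq hxy (Sum.elim id (Sum.inl ∘ g))

theorem exists_ultrafilter_averageType_eq_tp {M U : Type*} [L.Structure M] [L.Structure U]
    [Finite J] (e : M ↪ₑ[L] U) (a : J → U) :
    ∃ F : Ultrafilter (J → U), (∀ᶠ m : J → U in F, range m ⊆ range e) ∧
      averageType L F e = tp L (Sum.elim e a) := by
  let S (φ : tp L (Sum.elim e a)) : Set (J → U) :=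
    {m | range m ⊆ range e ∧ φ.1.Realize (Sum.elim e m)}
  have hne : ∀ φ, (S φ).Nonempty := fun ⟨φ, hφ⟩ => by
    have hex : (φ.iExs J).Realize (e ∘ id) := Formula.realize_iExs.2 ⟨a, hφ⟩
    obtain ⟨m, hm⟩ := Formula.realize_iExs.1 ((e.map_formula _ _).1 hex)
    refine ⟨e ∘ m, range_comp_subset_range m e, ?_⟩
    rw [← e.map_formula, Sum.comp_elim] at hm
    exact hm
  have hdir : Directed (· ≥ ·) fun φ => 𝓟 (S φ) := fun φ ψ => by
    have hinf : ∀ m : J → U, (φ.1 ⊓ ψ.1).Realize (Sum.elim e m) ↔ _ := fun m => Formula.realize_inf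
    exact ⟨⟨φ.1 ⊓ ψ.1, (hinf a).2 ⟨φ.2, ψ.2⟩⟩,
      principal_mono.2 fun m hm => ⟨hm.1, ((hinf m).1 hm.2).1⟩,
      principal_mono.2 fun m hm => ⟨hm.1, ((hinf m).1 hm.2).2⟩⟩
  have : Nonempty (tp L (Sum.elim e a)) := ⟨⟨⊤, Formula.realize_top.2 trivial⟩⟩
  have : (⨅ φ, 𝓟 (S φ)).NeBot :=
    iInf_neBot_of_directed' hdir fun φ => principal_neBot_iff.2 (hne φ)
  obtain ⟨F, hF⟩ := Ultrafilter.exists_le (⨅ φ, 𝓟 (S φ))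
  have hS : ∀ φ, ∀ᶠ m in F, m ∈ S φ := fun φ => hF (mem_iInf_of_mem φ (mem_principal_self _))
  refine ⟨F, (hS (Classical.arbitrary _)).mono fun m hm => hm.1, ?_⟩
  exact ((isComplete_tp _).eq_of_subset (isComplete_averageType F e) fun φ hφ =>
    (hS ⟨φ, hφ⟩).mono fun m hm => hm.2).symm

variable {U : Type w} [L.Structure U] {n : ℕ}

theorem IsSaturated.exists_tp_elim_eq_averageType (hU : IsSaturated L U)
    (F : Ultrafilter (Fin n → U)) (b : I → U) (hb : #(range b) < #U) :
    ∃ c, tp L (Sum.elim b c) = averageType L F b := by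
  obtain ⟨c, hc⟩ := hU.exists_realize b hb (averageType L F b) fun q hq =>
    ((eventually_all_finset q).2 fun φ hφ => hq hφ).exists
  exact ⟨c, ((isComplete_averageType F b).eq_of_subset (isComplete_tp _) hc).symm⟩

theorem IsSaturated.exists_forall_tp_elim_elim_eq_averageType {I : Type w} (hU : IsSaturated L U)
    (hunc : ℵ₀ < #U) (F : Ultrafilter (Fin n → U)) (b : I → U) (hI : #I < #U)
    {X : Set (Fin n → U)} (hX : #X < #U) :
    ∃ c, ∀ x ∈ X,
      tp L (Sum.elim (Sum.elim b x) c) = averageType L F (Sum.elim b x) := by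
  have hcard : #(I ⊕ X × Fin n) < #U := by
    have hn : (n : Cardinal.{w}) < #U := natCast_lt_aleph0.trans hunc
    simpa using add_lt_of_lt hunc.le hI (mul_lt_of_lt hunc.le hX hn)
  obtain ⟨c, hc⟩ := hU.exists_tp_elim_eq_averageType F
    (Sum.elim b fun p : X × Fin n => p.1.1 p.2) (mk_range_le.trans_lt hcard)
  refine ⟨c, fun x hx => ?_⟩
  have hcx := tp_elim_comp_eq_averageType hc (Sum.map id fun i => (⟨x, hx⟩, i))
  rwa [Sum.elim_comp_map] at hcx

end AverageTypes

section BoundedInvariantRelations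

theorem exists_subset_mk_le_forall_rel {α : Type w} (r : Setoid α) (S : Set α) :
    ∃ X ⊆ S, #X ≤ #(Quotient r) ∧ ∀ x ∈ S, ∃ y ∈ X, r y x := by
  obtain ⟨X, hXS, hX⟩ := exists_subset_bijOn S (Quotient.mk r)
  refine ⟨X, hXS, mk_le_of_injective hX.injOn.injective, fun x hx => ?_⟩
  obtain ⟨y, hyX, hyx⟩ := hX.surjOn (mem_image_of_mem _ hx)
  exact ⟨y, hyX, Quotient.exact hyx⟩

variable {L : FirstOrder.Language.{u, v}} {U : Type w} [L.Structure U] {n : ℕ}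

theorem IsSaturated.rel_of_tp_eq_averageType (hU : IsSaturated L U) (hunc : ℵ₀ < #U) {I : Type w}
    (hI : #I < #U) {b : I → U} {r : Setoid (Fin n → U)}
    (hr : ∀ f : U ≃[L] U, f ∘ b = b → ∀ x y, r x y → r (f ∘ x) (f ∘ y))
    {F : Ultrafilter (Fin n → U)} (hF : ∀ᶠ m : Fin n → U in F, range m ⊆ range b)
    {x y c : Fin n → U}
    (hx : tp L (Sum.elim (Sum.elim b x) c) = averageType L F (Sum.elim b x))
    (hy : tp L (Sum.elim (Sum.elim b y) c) = averageType L F (Sum.elim b y))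
    (hxy : tp L (Sum.elim b x) = tp L (Sum.elim b y)) (hxc : r x c) : r y c := by
  have hcard : #((I ⊕ Fin n) ⊕ Fin n) < #U := by
    have hn : (n : Cardinal.{w}) < #U := natCast_lt_aleph0.trans hunc
    simpa using add_lt_of_lt hunc.le (add_lt_of_lt hunc.le hI hn) hn
  have htp : tp L (Sum.elim (Sum.elim b x) c) = tp L (Sum.elim (Sum.elim b y) c) := by
    rw [hx, hy, averageType_elim_eq_of_tp_elim_eq hF hxy]
  obtain ⟨f, hf⟩ := hU.exists_equiv_comp_eq hU rfl hunc.le hcard htp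
  simp only [Sum.comp_elim, Sum.elim_eq_iff] at hf
  obtain ⟨⟨hfb, hfx⟩, hfc⟩ := hf
  simpa only [hfx, hfc] using hr f hfb x c hxc

theorem IsSaturated.rel_of_tp_eq (hU : IsSaturated L U) (hunc : ℵ₀ < #U) {M : Type w}
    [L.Structure M] (hM : #M < #U) (e : M ↪ₑ[L] U) {r : Setoid (Fin n → U)}
    (hr : ∀ f : U ≃[L] U, f ∘ e = e → ∀ x y, r x y → r (f ∘ x) (f ∘ y))
    (hbdd : #(Quotient r) < #U) {a b : Fin n → U}
    (hab : tp L (Sum.elim e a) = tp L (Sum.elim e b)) : r a b := by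
  obtain ⟨F, hFe, hFa⟩ := exists_ultrafilter_averageType_eq_tp e a
  obtain ⟨X, hXa, hXcard, hX⟩ :=
    exists_subset_mk_le_forall_rel r {x | tp L (Sum.elim e x) = tp L (Sum.elim e a)}
  have hX' : #(insert a (insert b X) : Set (Fin n → U)) < #U := by
    have hone : 1 < #U := one_lt_aleph0.trans hunc
    exact mk_insert_le.trans_lt (add_lt_of_lt hunc.le
      (mk_insert_le.trans_lt (add_lt_of_lt hunc.le (hXcard.trans_lt hbdd) hone)) hone)
  obtain ⟨c, hc⟩ := hU.exists_forall_tp_elim_elim_eq_averageType hunc F e hM hX'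
  have hca : tp L (Sum.elim e c) = tp L (Sum.elim e a) := by
    have hce := tp_elim_comp_eq_averageType (hc a (mem_insert a _)) Sum.inl
    rwa [Sum.elim_comp_inl, hFa] at hce
  obtain ⟨x, hxX, hxc⟩ := hX c hca
  have hconj : ∀ y ∈ insert a (insert b X), tp L (Sum.elim e y) = tp L (Sum.elim e a) → r y c :=
    fun y hy hya => hU.rel_of_tp_eq_averageType hunc hM hr hFe (hc x (.inr (.inr hxX))) (hc y hy)
      ((hXa hxX).trans hya.symm) hxc
  exact r.trans' (hconj a (.inl rfl) rfl) (r.symm' (hconj b (.inr (.inl rfl)) hab.symm))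

end BoundedInvariantRelations

section CountingFormulas

variable {L : FirstOrder.Language.{u, v}} {U : Type w}

theorem lift_card_le_mk_formula (L : FirstOrder.Language.{u, v}) (α : Type w) [Nonempty α] :
    Cardinal.lift.{w} L.card ≤ #(L.Formula α) := by
  let x : L.Term α := Term.var (Classical.arbitrary α)
  let toFormula : L.Symbols → L.Formula α :=
    Sum.elim (fun f => Term.equal (Term.func f.2 fun _ => x) x) fun R => R.2.formula fun _ => x
  have hinj : Function.Injective toFormula := by
    rintro (⟨k, f⟩ | ⟨k, R⟩) (⟨l, g⟩ | ⟨l, S⟩) h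
    · simp only [toFormula, Sum.elim_inl, Term.equal, Term.bdEqual, Term.relabel] at h
      injection h with _ hterm
      injection hterm with hkl hfg
      subst hkl
      rw [eq_of_heq hfg]
    · cases h
    · cases h
    · simp only [toFormula, Sum.elim_inr, Relations.formula, Relations.boundedFormula] at h
      injection h with _ hkl hRS
      subst hkl
      rw [eq_of_heq hRS]
  have hle := lift_mk_le_lift_mk_of_injective hinj
  rwa [lift_umax.{max u v, w}, lift_id'.{max u v, max u v w}] at hle

theorem infinite_formula (L : FirstOrder.Language.{u, v}) (α : Type*) : Infinite (L.Formula α) := by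
  refine not_finite_iff_infinite.1 fun _ => ?_
  have hinj : Function.Injective (Formula.not : L.Formula α → L.Formula α) := fun φ ψ h => by
    injection h
  obtain ⟨φ, hφ⟩ := Finite.surjective_of_injective hinj ⊥
  cases hφ

theorem mk_formula_le (L : FirstOrder.Language.{u, v}) (α : Type w) :
    #(L.Formula α) ≤ max ℵ₀ (Cardinal.lift.{max u v} #α + Cardinal.lift.{w} L.card) :=
  (mk_le_of_injective (sigma_mk_injective (i := 0))).trans BoundedFormula.card_le

theorem aleph0_le_cardFormulas (L : FirstOrder.Language.{u, v}) (A : Set U) :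
    ℵ₀ ≤ cardFormulas L A :=
  have := infinite_formula L[[A]] ℕ
  aleph0_le_mk _

theorem lift_mk_add_lift_card_le_cardFormulas (L : FirstOrder.Language.{u, v}) (A : Set U) :
    Cardinal.lift.{max u v} #A + Cardinal.lift.{w} L.card ≤ cardFormulas L A := by
  have hle := lift_card_le_mk_formula L[[A]] ℕ
  rwa [lift_uzero, card_withConstants, add_comm] at hle

theorem cardFormulas_lt (hunc : ℵ₀ < #U)
    (hL : Cardinal.lift.{w} L.card < Cardinal.lift.{max u v} #U) {A : Set U} (hA : #A < #U) :
    cardFormulas L A < Cardinal.lift.{max u v} #U := by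
  have hunc' : ℵ₀ < Cardinal.lift.{max u v} #U := by simpa using hunc
  refine (mk_formula_le _ _).trans_lt
    (max_lt hunc' (add_lt_of_lt hunc'.le (by simpa using hunc) ?_))
  rw [lift_uzero, card_withConstants]
  exact add_lt_of_lt hunc'.le hL (lift_lt.2 hA)

theorem mk_formula_sum_fin_le_cardFormulas {A : Set U} {M : Type w}
    (hM : Cardinal.lift.{max u v} #M ≤ cardFormulas L A) (n : ℕ) :
    #(L.Formula (M ⊕ Fin n)) ≤ cardFormulas L A := by
  have hinf := aleph0_le_cardFormulas L A
  have hn : (n : Cardinal) ≤ cardFormulas L A := natCast_le_aleph0.trans hinf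
  have hL : Cardinal.lift.{w} L.card ≤ cardFormulas L A :=
    le_add_self.trans (lift_mk_add_lift_card_le_cardFormulas L A)
  refine (mk_formula_le _ _).trans (max_le hinf (add_le_of_le hinf ?_ hL))
  simpa using add_le_of_le hinf hM hn

theorem exists_elementarySubstructure_lift_mk_eq_cardFormulas [L.Structure U] {A : Set U}
    (hA : cardFormulas L A ≤ Cardinal.lift.{max u v} #U) :
    ∃ M : L.ElementarySubstructure U, A ⊆ M ∧ Cardinal.lift.{max u v} #M = cardFormulas L A := by
  have hsum := lift_mk_add_lift_card_le_cardFormulas L A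
  obtain ⟨M, hAM, hM⟩ := exists_elementarySubstructure_card_eq L A (cardFormulas L A)
    (aleph0_le_cardFormulas L A)
    (by rw [lift_umax.{w, max u v}, lift_id'.{w, max u v w}]; exact le_self_add.trans hsum)
    (by rw [lift_umax.{max u v, w}, lift_id'.{max u v, max u v w}]; exact le_add_self.trans hsum)
    (by rwa [lift_umax.{w, max u v}, lift_id'.{w, max u v w}])
  rw [lift_umax.{w, max u v}, lift_id'.{w, max u v w}] at hM
  exact ⟨M, hAM, hM⟩

end CountingFormulas

section SetFamilies

variable {α : Type w}

/-- Two points are equivalent modulo a family of sets if they belong to the same members of the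
family. Applied to an orbit, this is the invariant relation with few classes. -/
def sameMembership (𝒞 : Set (Set α)) : Setoid α :=
  Setoid.ker fun x => {C : 𝒞 | x ∈ C.1}

theorem sameMembership_iff {𝒞 : Set (Set α)} {x y : α} :
    sameMembership 𝒞 x y ↔ ∀ C ∈ 𝒞, x ∈ C ↔ y ∈ C :=
  Setoid.ker_def.trans (Set.ext_iff.trans Subtype.forall)

theorem mk_quotient_sameMembership_le (𝒞 : Set (Set α)) :
    #(Quotient (sameMembership 𝒞)) ≤ 2 ^ #𝒞 := by
  rw [← mk_set]
  exact mk_le_of_injective (Setoid.kerLift_injective _)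

theorem lift_mk_le_two_power_of_sameMembership {β : Type v} {𝒞 : Set (Set α)} (t : α → β)
    (ht : ∀ x y, t x = t y → sameMembership 𝒞 x y) :
    Cardinal.lift.{v} #𝒞 ≤ 2 ^ Cardinal.lift.{w} #β := by
  have hpre : ∀ C ∈ 𝒞, t ⁻¹' (t '' C) = C := fun C hC =>
    (subset_preimage_image t C).antisymm' fun x ⟨y, hy, hyx⟩ =>
      (sameMembership_iff.1 (ht y x hyx) C hC).1 hy
  have hinj : Function.Injective fun C : 𝒞 => t '' C.1 := fun C D h =>
    Subtype.ext <| by rw [← hpre C C.2, ← hpre D D.2]; exact congrArg (t ⁻¹' ·) h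
  simpa using lift_mk_le_lift_mk_of_injective hinj

end SetFamilies

section Orbits

variable {L : FirstOrder.Language.{u, v}} {U : Type w} [L.Structure U] {n : ℕ} {A : Set U}
  {D : Set (Fin n → U)}

theorem preimage_mem_orbit {C : Set (Fin n → U)} (hC : C ∈ orbit L A D) {f : U ≃[L] U}
    (hf : ∀ a ∈ A, f a = a) : (f ∘ ·) ⁻¹' C ∈ orbit L A D := by
  obtain ⟨g, hg, rfl⟩ := hC
  refine ⟨f.symm.comp g, fun a ha => ?_, ?_⟩
  · rw [Equiv.comp_apply, hg a ha, ← hf a ha, f.symm_apply_apply, hf a ha]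
  · ext t
    refine exists_congr fun d => and_congr_right fun _ => ?_
    simp only [funext_iff, Function.comp_apply, Equiv.comp_apply]
    exact forall_congr' fun i => f.toEquiv.symm_apply_eq.symm

theorem sameMembership_orbit_comp {x y : Fin n → U} (h : sameMembership (orbit L A D) x y)
    {f : U ≃[L] U} (hf : ∀ a ∈ A, f a = a) :
    sameMembership (orbit L A D) (f ∘ x) (f ∘ y) :=
  sameMembership_iff.2 fun _ hC => sameMembership_iff.1 h _ (preimage_mem_orbit hC hf)

theorem IsSaturated.lift_mk_orbit_le (hU : IsSaturated L U) (hunc : ℵ₀ < #U)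
    (hD : 2 ^ #(orbit L A D) < #U) (M : L.ElementarySubstructure U) (hAM : A ⊆ M) (hM : #M < #U) :
    Cardinal.lift.{max u v} #(orbit L A D) ≤
      (2 : Cardinal.{max u v w}) ^ (2 : Cardinal.{max u v w}) ^ #(L.Formula (M ⊕ Fin n)) := by
  have hinv : ∀ f : U ≃[L] U, f ∘ M.subtype = M.subtype → ∀ x y,
      sameMembership (orbit L A D) x y → sameMembership (orbit L A D) (f ∘ x) (f ∘ y) :=
    fun f hf x y hxy => sameMembership_orbit_comp hxy fun a ha => congrFun hf ⟨a, hAM ha⟩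
  have hbdd := (mk_quotient_sameMembership_le (orbit L A D)).trans_lt hD
  have hle := lift_mk_le_two_power_of_sameMembership (fun x => tp L (Sum.elim M.subtype x))
    fun x y hxy => hU.rel_of_tp_eq hunc hM M.subtype hinv hbdd hxy
  rwa [lift_umax.{w, max u v}, mk_set, lift_two_power, lift_id'.{w, max u v w}] at hle

end Orbits

theorem two_power_lt_lift {c : Cardinal.{w}} (hc : IsStrongLimit c) {d : Cardinal.{max u w}}
    (hd : d < Cardinal.lift.{u} c) : (2 : Cardinal.{max u w}) ^ d < Cardinal.lift.{u} c := by
  obtain ⟨e, _, rfl⟩ := lt_lift_iff.1 hd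
  rw [← lift_two_power, lift_lt]
  exact hc.isStrongPrelimit (lift_lt.1 hd)

end LascarOrbit

open LascarOrbit in
theorem mainTheorem10_general (L : FirstOrder.Language.{u, v}) (U : Type w) [L.Structure U]
    (hsat : IsSaturated L U) (hunc : ℵ₀ < #U) (hlim : (#U).IsStrongLimit)
    (hL : Cardinal.lift.{w} L.card < Cardinal.lift.{max u v} #U)
    (A : Set U) (hA : #A < #U) (n : ℕ) (D : Set (Fin n → U)) :
    #(orbit L A D) < #U ↔
      Cardinal.lift.{max u v} #(orbit L A D) ≤
        (2 : Cardinal.{max u v w}) ^ ((2 : Cardinal.{max u v w}) ^ cardFormulas L A) := by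
  have hlt := cardFormulas_lt hunc hL hA
  constructor
  · intro hD
    obtain ⟨M, hAM, hM⟩ := exists_elementarySubstructure_lift_mk_eq_cardFormulas hlt.le
    have hformulas := mk_formula_sum_fin_le_cardFormulas hM.le n
    exact (hsat.lift_mk_orbit_le hunc (hlim.isStrongPrelimit hD) M hAM
      (lift_lt.1 (hM.trans_lt hlt))).trans
      (power_le_power_left two_ne_zero (power_le_power_left two_ne_zero hformulas))
  · intro hD
    exact lift_lt.1 (hD.trans_lt (two_power_lt_lift hlim (two_power_lt_lift hlim hlt)))

theorem mainTheorem10 (L : FirstOrder.Language.{u, v}) (U : Type w) [L.Structure U]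
    (hsat : LascarOrbit.IsSaturated L U)
    (hinacc : (#U).IsInaccessible)
    (hL : Cardinal.lift.{w} L.card < Cardinal.lift.{max u v} #U)
    (A : Set U) (hA : #A < #U)
    (n : ℕ) (D : Set (Fin n → U)) :
    #(LascarOrbit.orbit L A D) < #U ↔
      Cardinal.lift.{max u v} #(LascarOrbit.orbit L A D) ≤
        (2 : Cardinal.{max u v w}) ^ ((2 : Cardinal.{max u v w}) ^ LascarOrbit.cardFormulas L A) :=
  mainTheorem10_general L U hsat hinacc.aleph0_lt hinacc.isStrongLimit hL A hA n D
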